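/- Let $K$ be a field and $C$ a coalgebra over $K$, and let $C^*=\mathrm{Hom}_K(C,K)$ be its dual algebra with the convolution product $(f*g)(c)=\sum f(c_1)g(c_2)$. Regard $C$ as a left $C^*$-module by $f\cdot c=\sum f(c_2)c_1$ and as a right $C^*$-module by $c\cdot f=\sum f(c_1)c_2$. For a left (respectively right) $C^*$-module $M$, let $\mathrm{Rat}(M)$ be the submodule of all $m\in M$ for which there are finitely many $m_i\in M$, $c_i\in C$ with $f\cdot m=\sum_i f(c_i)m_i$ (respectively $m\cdot f=\sum_i f(c_i)m_i$) for all $f\in C^*$; write ${}_{C^*}C^*$ and $C^*_{C^*}$ for $C^*$ as a left and as a right module over itself. For a module $M$ and a set $I$, $M^{(I)}$ is the direct sum of $I$ copies of $M$. The coalgebra $C$ is co-Frobenius if there are a monomorphism $C\to C^*$ of left $C^*$-modules and a monomorphism $C\to C^*$ of right $C^*$-modules; it is QcF (quasi-co-Frobenius) if there are a monomorphism $C\to (C^*)^{(I)}$ of left $C^*$-modules and a monomorphism $C\to (C^*)^{(J)}$ of right $C^*$-modules for some sets $I,J$. (i) Suppose that $C$ is nonzero and QcF, and that $I,J$ are sets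 such that $C^{(I)}\simeq(\mathrm{Rat}(C^*_{C^*}))^{(J)}$ as right $C^*$-modules. Then $I$ is finite if and only if $J$ is finite. (ii) The following are equivalent: $C$ is co-Frobenius; $C\simeq\mathrm{Rat}({}_{C^*}C^*)$ as left $C^*$-modules; $C\simeq\mathrm{Rat}(C^*_{C^*})$ as right $C^*$-modules. -/

import Mathlib

open scoped TensorProduct

namespace CoalgebraDual

section Defs

variable (K : Type*) (C : Type*) [Field K] [AddCommGroup C] [Module K C] [Coalgebra K C]

/-- The dual algebra `C* = Hom_K(C, K)` of a coalgebra `C`, with the convolution product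
`(f * g)(c) = ∑ f(c₁) g(c₂)` and with the counit as unit. -/
abbrev DualAlg : Type _ := WithConv (C →ₗ[K] K)

variable {K C}

/-- The map `c ↦ ∑ f(c₂) c₁`, as a `K`-linear endomorphism of `C`. -/
def leftAct (f : DualAlg K C) : C →ₗ[K] C :=
  (TensorProduct.rid K C).toLinearMap ∘ₗ f.ofConv.lTensor C ∘ₗ Coalgebra.comul

/-- The map `c ↦ ∑ f(c₁) c₂`, as a `K`-linear endomorphism of `C`. -/
def rightAct (f : DualAlg K C) : C →ₗ[K] C :=
  (TensorProduct.lid K C).toLinearMap ∘ₗ f.ofConv.rTensor C ∘ₗ Coalgebra.comul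

theorem rid_lTensor_mul {M : Type*} [AddCommGroup M] [Module K M]
    (f g : DualAlg K C) (t : M ⊗[K] C) :
    TensorProduct.rid K M ((f * g).ofConv.lTensor M t) =
      TensorProduct.rid K M (f.ofConv.lTensor M ((leftAct g).lTensor M t)) := by
  induction t with
  | zero => simp
  | add x y hx hy => simp only [map_add, hx, hy]
  | tmul m c =>
    simp only [LinearMap.lTensor_tmul, TensorProduct.rid_tmul, LinearMap.comp_apply, leftAct]
    congr 1
    change (f * g) c = _
    rw [LinearMap.convMul_apply]
    induction (Coalgebra.comul (R := K) c) with
    | zero => simp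
    | add x y hx hy => simp only [map_add, hx, hy]
    | tmul a b => simp [mul_comm]

theorem lid_rTensor_mul {M : Type*} [AddCommGroup M] [Module K M]
    (f g : DualAlg K C) (t : C ⊗[K] M) :
    TensorProduct.lid K M ((f * g).ofConv.rTensor M t) =
      TensorProduct.lid K M (g.ofConv.rTensor M ((rightAct f).rTensor M t)) := by
  induction t with
  | zero => simp
  | add x y hx hy => simp only [map_add, hx, hy]
  | tmul c m =>
    simp only [LinearMap.rTensor_tmul, TensorProduct.lid_tmul, LinearMap.comp_apply, rightAct]
    congr 1
    change (f * g) c = _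
    rw [LinearMap.convMul_apply]
    induction (Coalgebra.comul (R := K) c) with
    | zero => simp
    | add x y hx hy => simp only [map_add, hx, hy]
    | tmul a b => simp

theorem comul_leftAct (f : DualAlg K C) (c : C) :
    Coalgebra.comul (R := K) (leftAct f c) =
      (leftAct f).lTensor C (Coalgebra.comul (R := K) c) := by
  have key : ∀ t : C ⊗[K] C,
      Coalgebra.comul (R := K) (TensorProduct.rid K C (f.ofConv.lTensor C t)) =
        ((TensorProduct.rid K C).toLinearMap ∘ₗ f.ofConv.lTensor C).lTensor C
          (TensorProduct.assoc K C C C ((Coalgebra.comul (R := K)).rTensor C t)) := by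
    intro t
    induction t with
    | zero => simp
    | add x y hx hy => simp only [map_add, hx, hy]
    | tmul a b =>
      simp only [LinearMap.lTensor_tmul, TensorProduct.rid_tmul, LinearMap.rTensor_tmul, map_smul]
      induction (Coalgebra.comul (R := K) a) with
      | zero => simp
      | add x y hx hy => simp only [TensorProduct.add_tmul, smul_add, map_add, hx, hy]
      | tmul a b => simp
  have h := key (Coalgebra.comul (R := K) c)
  rw [Coalgebra.coassoc_apply] at h
  refine h.trans ?_
  rw [← LinearMap.comp_apply, ← LinearMap.lTensor_comp]
  rfl

theorem comul_rightAct (f : DualAlg K C) (c : C) :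
    Coalgebra.comul (R := K) (rightAct f c) =
      (rightAct f).rTensor C (Coalgebra.comul (R := K) c) := by
  have key : ∀ t : C ⊗[K] C,
      Coalgebra.comul (R := K) (TensorProduct.lid K C (f.ofConv.rTensor C t)) =
        ((TensorProduct.lid K C).toLinearMap ∘ₗ f.ofConv.rTensor C).rTensor C
          ((TensorProduct.assoc K C C C).symm ((Coalgebra.comul (R := K)).lTensor C t)) := by
    intro t
    induction t with
    | zero => simp
    | add x y hx hy => simp only [map_add, hx, hy]
    | tmul a b =>
      simp only [LinearMap.lTensor_tmul, TensorProduct.lid_tmul, LinearMap.rTensor_tmul, map_smul]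
      induction (Coalgebra.comul (R := K) b) with
      | zero => simp
      | add x y hx hy => simp only [TensorProduct.tmul_add, smul_add, map_add, hx, hy]
      | tmul a b => simp [TensorProduct.smul_tmul']
  have h := key (Coalgebra.comul (R := K) c)
  rw [Coalgebra.coassoc_symm_apply] at h
  refine h.trans ?_
  rw [← LinearMap.comp_apply, ← LinearMap.rTensor_comp]
  rfl

/-- The left `C*`-module structure on `C`: `f • c = ∑ f(c₂) c₁`. -/
instance leftModule : Module (DualAlg K C) C where
  smul f c := leftAct f c
  one_smul c := by
    change TensorProduct.rid K C ((Coalgebra.counit (R := K) (A := C)).lTensor C _) = c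
    simp
  mul_smul f g c := by
    change leftAct (f * g) c = leftAct f (leftAct g c)
    refine (rid_lTensor_mul f g _).trans ?_
    rw [← comul_leftAct]
    rfl
  smul_zero f := map_zero (leftAct f)
  smul_add f c d := map_add (leftAct f) c d
  add_smul f g c := by
    change TensorProduct.rid K C ((f.ofConv + g.ofConv).lTensor C _) = _
    simp only [LinearMap.lTensor_add, LinearMap.add_apply, map_add]
    rfl
  zero_smul c := by
    change TensorProduct.rid K C ((0 : C →ₗ[K] K).lTensor C _) = 0
    simp

/-- The right `C*`-module structure on `C`: `c · f = ∑ f(c₁) c₂`.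
Right modules are left modules over the opposite algebra, as usual in Mathlib. -/
instance rightModule : Module (DualAlg K C)ᵐᵒᵖ C where
  smul f c := rightAct f.unop c
  one_smul c := by
    change TensorProduct.lid K C ((Coalgebra.counit (R := K) (A := C)).rTensor C _) = c
    simp
  mul_smul f g c := by
    change rightAct (g.unop * f.unop) c = rightAct f.unop (rightAct g.unop c)
    refine (lid_rTensor_mul g.unop f.unop _).trans ?_
    rw [← comul_rightAct]
    rfl
  smul_zero f := map_zero (rightAct f.unop)
  smul_add f c d := map_add (rightAct f.unop) c d
  add_smul f g c := by
    change TensorProduct.lid K C ((f.unop.ofConv + g.unop.ofConv).rTensor C _) = _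
    simp only [LinearMap.rTensor_add, LinearMap.add_apply, map_add]
    rfl
  zero_smul c := by
    change TensorProduct.lid K C ((0 : C →ₗ[K] K).rTensor C _) = 0
    simp

variable (K C)

/-- The rational part of a left `C*`-module `M`: the submodule of all `m` for which there is a
tensor `∑ mᵢ ⊗ cᵢ ∈ M ⊗ C` with `f • m = ∑ f(cᵢ) mᵢ` for all `f ∈ C*`. -/
def leftRat (M : Type*) [AddCommGroup M] [Module K M] [Module (DualAlg K C) M]
    [IsScalarTower K (DualAlg K C) M] : Submodule (DualAlg K C) M where
  carrier := {m | ∃ t : M ⊗[K] C, ∀ f : DualAlg K C,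
    f • m = TensorProduct.rid K M (f.ofConv.lTensor M t)}
  zero_mem' := ⟨0, fun f => by simp⟩
  add_mem' := by
    rintro a b ⟨s, hs⟩ ⟨t, ht⟩
    exact ⟨s + t, fun f => by rw [smul_add, hs, ht, map_add, map_add]⟩
  smul_mem' := by
    rintro g m ⟨t, ht⟩
    exact ⟨(leftAct g).lTensor M t, fun f => by rw [← mul_smul, ht, rid_lTensor_mul]⟩

/-- The rational part of a right `C*`-module `M`: the submodule of all `m` for which there is a
tensor `∑ cᵢ ⊗ mᵢ ∈ C ⊗ M` with `m · f = ∑ f(cᵢ) mᵢ` for all `f ∈ C*`. -/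
def rightRat (M : Type*) [AddCommGroup M] [Module K M] [Module (DualAlg K C)ᵐᵒᵖ M]
    [IsScalarTower K (DualAlg K C)ᵐᵒᵖ M] : Submodule (DualAlg K C)ᵐᵒᵖ M where
  carrier := {m | ∃ t : C ⊗[K] M, ∀ f : DualAlg K C,
    MulOpposite.op f • m = TensorProduct.lid K M (f.ofConv.rTensor M t)}
  zero_mem' := ⟨0, fun f => by simp⟩
  add_mem' := by
    rintro a b ⟨s, hs⟩ ⟨t, ht⟩
    exact ⟨s + t, fun f => by rw [smul_add, hs, ht, map_add, map_add]⟩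
  smul_mem' := by
    rintro g m ⟨t, ht⟩
    refine ⟨(rightAct g.unop).rTensor M t, fun f => ?_⟩
    rw [← mul_smul, ← lid_rTensor_mul, ← ht]
    rfl

/-- `C` is left co-Frobenius: there is a monomorphism `C → C*` of left `C*`-modules. -/
def IsLeftCoFrobenius : Prop :=
  ∃ φ : C →ₗ[DualAlg K C] DualAlg K C, Function.Injective φ

/-- `C` is right co-Frobenius: there is a monomorphism `C → C*` of right `C*`-modules. -/
def IsRightCoFrobenius : Prop :=
  ∃ φ : C →ₗ[(DualAlg K C)ᵐᵒᵖ] DualAlg K C, Function.Injective φ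

/-- `C` is co-Frobenius: it is both left and right co-Frobenius. -/
def IsCoFrobenius : Prop :=
  IsLeftCoFrobenius K C ∧ IsRightCoFrobenius K C

end Defs

section QcF

universe u v

variable (K : Type u) (C : Type v) [Field K] [AddCommGroup C] [Module K C] [Coalgebra K C]

/-- `C` is left QcF: `C` embeds, as a left `C*`-module, in a direct sum of copies of `C*`.
(An embedding only meets as many summands as the union of the supports of the images, which is a
set of cardinality at most `max (#C) ℵ₀`, so index sets in the universe of `C` are enough.) -/
def IsLeftQcF : Prop :=
  ∃ (I : Type v) (φ : C →ₗ[DualAlg K C] (I →₀ DualAlg K C)), Function.Injective φ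

/-- `C` is right QcF: `C` embeds, as a right `C*`-module, in a direct sum of copies of `C*`. -/
def IsRightQcF : Prop :=
  ∃ (I : Type v) (φ : C →ₗ[(DualAlg K C)ᵐᵒᵖ] (I →₀ DualAlg K C)), Function.Injective φ

/-- `C` is quasi-co-Frobenius (QcF): it is both left and right QcF. -/
def IsQcF : Prop :=
  IsLeftQcF K C ∧ IsRightQcF K C

end QcF

end CoalgebraDual

/-! Write `f * g` for the convolution product, which is both `f ∘ l g` and `g ∘ r f`. A functional
`g` is rational on the left exactly when `C* * g` is finite-dimensional, that is, when `l g` has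
finite rank; on the right the same holds with `r g`. A module map from `C` to `C*`, left or right,
amounts to a bilinear form for which the two actions are adjoint (`Balanced`); the sides differ by a
flip.

The engine is local units: a separating space of functionals agrees with the counit on any given
finite-dimensional subspace (`Separating.exists_eqOn`).

For (ii), co-Frobenius yields two balanced forms, nondegenerate on opposite sides, and
`Balanced.injective` shows that one of them is nondegenerate on both. Its range is then the whole
rational part (`Balanced.range_eq`). Conversely, a form nondegenerate on one side whose range is the
whole rational part is nondegenerate on the other (`Balanced.injective_flip`).

For (i), QcF serves only to make the finite-rank functionals separating on both sides. When `I` is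
finite, `J →₀ K` embeds in a finite power of a finite-dimensional space; when `J` is finite, `I →₀
K` is a quotient of a subspace of such a power. -/

namespace CoalgebraDual

open Module WithConv

/-! ### Separating spaces of functionals and finite-dimensional duality. -/

section Separating

variable {K V : Type*} [Field K] [AddCommGroup V] [Module K V]

/-- A space of functionals is separating if its common kernel vanishes. -/
def Separating (P : Submodule K (Dual K V)) : Prop :=
  ∀ v, (∀ p ∈ P, p v = 0) → v = 0

/-- The restrictions of `P` to `W` have no common zero but `0`, so by the double annihilator theorem
they fill the finite-dimensional dual of `W`. -/
theorem Separating.exists_eqOn {P : Submodule K (Dual K V)} (hP : Separating P)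
    (W : Submodule K V) [FiniteDimensional K W] (f : Dual K V) :
    ∃ p ∈ P, ∀ w ∈ W, p w = f w := by
  have htop : P.map W.subtype.dualMap = ⊤ := by
    rw [← Subspace.dualCoannihilator_dualAnnihilator_eq (W := P.map W.subtype.dualMap)]
    have : (P.map W.subtype.dualMap).dualCoannihilator = ⊥ := by
      rw [eq_bot_iff]
      intro w hw
      rw [Submodule.mem_dualCoannihilator] at hw
      have : (w : V) = 0 := hP _ fun p hp => hw _ (Submodule.mem_map_of_mem hp)
      simpa using this
    rw [this, Submodule.dualAnnihilator_bot]
  obtain ⟨p, hp, h⟩ : W.subtype.dualMap f ∈ P.map W.subtype.dualMap := htop ▸ Submodule.mem_top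
  exact ⟨p, hp, fun w hw => LinearMap.congr_fun h ⟨w, hw⟩⟩

/-- A finite-dimensional space of functionals is closed. -/
theorem exists_apply_ne_zero_of_notMem (P : Submodule K (Dual K V)) [FiniteDimensional K P]
    {f : Dual K V} (hf : f ∉ P) : ∃ v, (∀ p ∈ P, p v = 0) ∧ f v ≠ 0 := by
  by_contra! h
  apply hf
  rw [← Subspace.dualCoannihilator_dualAnnihilator_eq (W := P), Submodule.mem_dualAnnihilator]
  exact fun v hv => h v fun p hp => (Submodule.mem_dualCoannihilator v).1 hv p hp

/-- An injective map from a finite-dimensional space to a dual space realizes every functional as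
the evaluation at a vector. -/
theorem exists_eval_eq (M : Submodule K V) [FiniteDimensional K M] (B : V →ₗ[K] Dual K V)
    (hB : Function.Injective B) (f : Dual K V) : ∃ x, ∀ m ∈ M, B m x = f m := by
  have hs : Separating (LinearMap.range B.flip) := fun v hv =>
    hB (by ext d; simpa using hv _ ⟨d, rfl⟩)
  obtain ⟨_, ⟨x, rfl⟩, hx⟩ := hs.exists_eqOn M f
  exact ⟨x, hx⟩

theorem dual_ext {x y : V} (h : ∀ f : Dual K V, f x = f y) : x = y := by
  rw [← sub_eq_zero, ← Module.forall_dual_apply_eq_zero_iff K]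
  intro f
  rw [map_sub, h, sub_self]

theorem finite_range_of_finite_range_dualMap (T : V →ₗ[K] V)
    (h : FiniteDimensional K (LinearMap.range T.dualMap)) :
    FiniteDimensional K (LinearMap.range T) := by
  have hinj : Function.Injective T.rangeRestrict.dualMap :=
    LinearMap.dualMap_injective_of_surjective T.surjective_rangeRestrict
  have hle : LinearMap.range T.rangeRestrict.dualMap ≤ LinearMap.range T.dualMap := by
    rintro _ ⟨f, rfl⟩
    obtain ⟨g, rfl⟩ := LinearMap.dualMap_surjective_of_injective
      (LinearMap.range T).subtype_injective f
    exact ⟨g, rfl⟩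
  have : FiniteDimensional K (LinearMap.range T.rangeRestrict.dualMap) :=
    Submodule.finiteDimensional_of_le hle
  have : FiniteDimensional K (Dual K (LinearMap.range T)) :=
    Module.Finite.equiv (LinearEquiv.ofInjective _ hinj).symm
  exact (Module.finite_dual_iff K).1 this

end Separating

/-! ### Adjoint actions of the dual and finite-rank functionals. -/

/-- Two commuting, locally finite actions of the dual of `C` on `C`, adjoint to each other: the
data a coalgebra structure induces on `C`. Interchanging the two actions is passing to the
co-opposite coalgebra. -/
structure DualAction (K C : Type*) [Field K] [AddCommGroup C] [Module K C] where
  l : Dual K C →ₗ[K] C →ₗ[K] C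
  r : Dual K C →ₗ[K] C →ₗ[K] C
  counit : Dual K C
  l_counit : ∀ c, l counit c = c
  r_counit : ∀ c, r counit c = c
  adj : ∀ (f g : Dual K C) (c : C), f (l g c) = g (r f c)
  comm : ∀ f g c, l f (r g c) = r g (l f c)
  finite_l : ∀ c, FiniteDimensional K (LinearMap.range (l.flip c))
  finite_r : ∀ c, FiniteDimensional K (LinearMap.range (r.flip c))

namespace DualAction

variable {K C : Type*} [Field K] [AddCommGroup C] [Module K C] (D : DualAction K C)

/-- The data with the two actions interchanged. -/
def symm : DualAction K C where
  l := D.r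
  r := D.l
  counit := D.counit
  l_counit := D.r_counit
  r_counit := D.l_counit
  adj f g c := (D.adj g f c).symm
  comm f g c := (D.comm g f c).symm
  finite_l := D.finite_r
  finite_r := D.finite_l

theorem counit_l (f : Dual K C) (c : C) : D.counit (D.l f c) = f c := by
  rw [D.adj, D.r_counit]

theorem counit_r (f : Dual K C) (c : C) : D.counit (D.r f c) = f c :=
  D.symm.counit_l f c

theorem l_comp (f g : Dual K C) : D.l (f ∘ₗ D.l g) = D.l f ∘ₗ D.l g := by
  ext c
  refine dual_ext (K := K) fun h => ?_
  rw [D.adj, LinearMap.comp_apply, LinearMap.comp_apply, D.comm, ← D.adj]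

theorem r_comp (f g : Dual K C) : D.r (f ∘ₗ D.l g) = D.r g ∘ₗ D.r f := by
  have : f ∘ₗ D.l g = g ∘ₗ D.r f := LinearMap.ext fun c => D.adj f g c
  rw [this]
  exact D.symm.l_comp g f

/-- The functionals acting on the left with finite rank. -/
def finiteRankLeft : Submodule K (Dual K C) where
  carrier := {g | FiniteDimensional K (LinearMap.range (D.l g))}
  zero_mem' := by
    change FiniteDimensional K (LinearMap.range (D.l 0))
    rw [map_zero, LinearMap.range_zero]
    infer_instance
  add_mem' := by
    intro f g (hf : FiniteDimensional K _) (hg : FiniteDimensional K _)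
    change FiniteDimensional K (LinearMap.range (D.l (f + g)))
    rw [map_add]
    exact Submodule.finiteDimensional_of_le (LinearMap.range_add_le (D.l f) (D.l g))
  smul_mem' := by
    intro a f (hf : FiniteDimensional K _)
    change FiniteDimensional K (LinearMap.range (D.l (a • f)))
    refine Submodule.finiteDimensional_of_le (S₂ := LinearMap.range (D.l f)) ?_
    rintro _ ⟨c, rfl⟩
    exact ⟨a • c, by simp⟩

/-- The functionals acting on the right with finite rank. -/
def finiteRankRight : Submodule K (Dual K C) := D.symm.finiteRankLeft

theorem mem_finiteRankLeft {g : Dual K C} :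
    g ∈ D.finiteRankLeft ↔ FiniteDimensional K (LinearMap.range (D.l g)) := Iff.rfl

theorem mem_finiteRankRight {g : Dual K C} :
    g ∈ D.finiteRankRight ↔ FiniteDimensional K (LinearMap.range (D.r g)) := Iff.rfl

theorem comp_mem_finiteRankRight {p : Dual K C} (hp : p ∈ D.finiteRankRight) (g : Dual K C) :
    p ∘ₗ D.l g ∈ D.finiteRankRight := by
  rw [mem_finiteRankRight] at hp ⊢
  rw [r_comp, LinearMap.range_comp]
  infer_instance

/-- Some `p` of finite right rank agrees with the counit on the range of `l g`, so `p * g = g`;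
functionals of finite right rank form a right ideal. -/
theorem finiteRankLeft_le (h : Separating D.finiteRankRight) :
    D.finiteRankLeft ≤ D.finiteRankRight := by
  intro g hg
  rw [mem_finiteRankLeft] at hg
  obtain ⟨p, hp, hpg⟩ := h.exists_eqOn (LinearMap.range (D.l g)) D.counit
  have : p ∘ₗ D.l g = g := by
    ext c
    rw [LinearMap.comp_apply, hpg _ ⟨c, rfl⟩, counit_l]
  exact this ▸ D.comp_mem_finiteRankRight hp g

theorem finiteRank_eq (hl : Separating D.finiteRankLeft) (hr : Separating D.finiteRankRight) :
    D.finiteRankLeft = D.finiteRankRight :=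
  le_antisymm (D.finiteRankLeft_le hr) (D.symm.finiteRankLeft_le hl)

/-! ### Balanced bilinear forms. -/

/-- A bilinear form is balanced if the two actions are adjoint with respect to it. -/
def Balanced (B : C →ₗ[K] Dual K C) : Prop :=
  ∀ f c d, B (D.l f c) d = B c (D.r f d)

variable {D} {B B' : C →ₗ[K] Dual K C}

theorem Balanced.flip (hB : D.Balanced B) : D.symm.Balanced B.flip :=
  fun f c d => (hB f d c).symm

/-- Balance gives `f * B c = B (l f c)`, and the orbit of `c` is finite-dimensional. -/
theorem Balanced.apply_mem (hB : D.Balanced B) (c : C) : B c ∈ D.finiteRankLeft := by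
  refine finite_range_of_finite_range_dualMap _ ?_
  have := D.finite_l c
  refine Submodule.finiteDimensional_of_le (S₂ := (LinearMap.range (D.l.flip c)).map B) ?_
  rintro _ ⟨f, rfl⟩
  refine ⟨D.l f c, ⟨f, rfl⟩, ?_⟩
  ext d
  rw [hB, LinearMap.dualMap_apply, D.adj]

theorem Balanced.flip_apply_mem (hB : D.Balanced B) (c : C) : B.flip c ∈ D.finiteRankRight :=
  hB.flip.apply_mem c

theorem Balanced.separating_right (hB : D.Balanced B) (hi : Function.Injective B) :
    Separating D.finiteRankRight := fun c hc =>
  hi (by ext d; simpa using hc _ (hB.flip_apply_mem d))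

theorem Balanced.finiteRankRight_le (hB : D.Balanced B) (hi : Function.Injective B) :
    D.finiteRankRight ≤ D.finiteRankLeft := by
  intro p hp
  rw [mem_finiteRankRight] at hp
  refine finite_range_of_finite_range_dualMap _ ?_
  refine Submodule.finiteDimensional_of_le (S₂ := (LinearMap.range (D.r p)).map B.flip) ?_
  rintro _ ⟨f, rfl⟩
  set q : Dual K C := f ∘ₗ D.l p with hq
  change q ∈ _
  by_contra hmem
  -- Here `c` is `B`-orthogonal to the range of `r p`. Representing the counit on the orbit of `c`
  -- as `B · x` turns `q c` into `B c (r q x)`, which vanishes because `r q = r p ∘ r f`.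
  obtain ⟨c, hc, hqc⟩ := exists_apply_ne_zero_of_notMem _ hmem
  have := D.finite_l c
  obtain ⟨x, hx⟩ := exists_eval_eq (LinearMap.range (D.l.flip c)) B hi D.counit
  refine hqc ?_
  rw [← D.counit_l q c, ← hx (D.l q c) ⟨q, rfl⟩, hB, hq, r_comp]
  exact hc _ (Submodule.mem_map_of_mem ⟨_, rfl⟩)

theorem Balanced.finiteRank_eq (hB : D.Balanced B) (hi : Function.Injective B) :
    D.finiteRankLeft = D.finiteRankRight :=
  le_antisymm (D.finiteRankLeft_le (hB.separating_right hi)) (hB.finiteRankRight_le hi)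

theorem Balanced.l_apply (hB : D.Balanced B) (a y : C) : D.l (B a) y = D.r (B.flip y) a := by
  refine dual_ext (K := K) fun f => ?_
  rw [D.adj, ← hB, ← LinearMap.flip_apply, D.adj]

theorem Balanced.comp_l (hB : D.Balanced B) (g : Dual K C) (y : C) :
    g ∘ₗ D.l (B y) = B (D.l g y) := by
  ext c
  rw [hB, LinearMap.comp_apply, D.adj]

theorem separating_range_of_injective_flip (hi : Function.Injective B.flip) :
    Separating (LinearMap.range B) := fun c hc =>
  hi (by ext d; simpa using hc _ ⟨d, rfl⟩)

/-- For `c` in the kernel of `B'`, let `A` be its finite-dimensional orbit under `r`. A suitable `y`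
makes `B' ∘ r (B.flip y)` coincide with `B` on `A`. So `r (B.flip y)` is injective on `A`, hence
onto, and `c` is the image of some `a` with `B a = B' c = 0`. -/
theorem Balanced.injective (hB : D.Balanced B) (hi : Function.Injective B)
    (hB' : D.Balanced B') (hi' : Function.Injective B'.flip) : Function.Injective B' := by
  rw [injective_iff_map_eq_zero]
  intro c hc
  let A : Submodule K C := LinearMap.range (D.r.flip c)
  have hA : FiniteDimensional K A := D.finite_r c
  let T : C →ₗ[K] C →ₗ[K] C := D.r.comp B
  -- `W` contains the ranges of all `r (B a)` with `a ∈ A`. It is finite-dimensional since each `B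
  -- a` has finite left rank, hence finite right rank.
  let W : Submodule K C := ⨆ i, LinearMap.range (T (Module.finBasis K A i : C))
  have hW : FiniteDimensional K W := by
    have : ∀ i, FiniteDimensional K (LinearMap.range (T (Module.finBasis K A i : C))) := fun i =>
      (hB.finiteRank_eq hi).le (hB.apply_mem _)
    exact Submodule.finiteDimensional_iSup _
  have hmemW : ∀ a ∈ A, ∀ d, T a d ∈ W := by
    intro a ha d
    have h : (⟨a, ha⟩ : A) = _ := ((Module.finBasis K A).sum_repr ⟨a, ha⟩).symm
    have h' := congrArg (fun x : A => T x d) h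
    simp only [Submodule.coe_sum, map_sum, LinearMap.sum_apply, Submodule.coe_smul, map_smul,
      LinearMap.smul_apply] at h'
    rw [h']
    exact Submodule.sum_mem _ fun i _ => Submodule.smul_mem _ _
      (Submodule.mem_iSup_of_mem i ⟨d, rfl⟩)
  obtain ⟨_, ⟨y, rfl⟩, hy⟩ :=
    (separating_range_of_injective_flip hi').exists_eqOn W D.counit
  have key : ∀ a ∈ A, B' (D.r (B.flip y) a) = B a := by
    intro a ha
    rw [← hB.l_apply, ← hB'.comp_l]
    ext d
    rw [LinearMap.comp_apply, D.adj, hy (D.r (B a) d) (hmemW a ha d), counit_r]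
  have hst : ∀ a ∈ A, D.r (B.flip y) a ∈ A := by
    rintro _ ⟨f, rfl⟩
    exact ⟨f ∘ₗ D.l (B.flip y), by simp [r_comp]⟩
  have hinj : Function.Injective ((D.r (B.flip y)).restrict hst) := by
    rw [injective_iff_map_eq_zero]
    rintro ⟨a, ha⟩ h
    have h0 : D.r (B.flip y) a = 0 := congrArg Subtype.val h
    have := key a ha
    rw [h0, map_zero] at this
    exact Subtype.ext (hi (by simpa using this.symm))
  have hcA : c ∈ A := ⟨D.counit, D.r_counit c⟩
  obtain ⟨⟨a, ha⟩, h⟩ := LinearMap.surjective_of_injective hinj ⟨c, hcA⟩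
  have h0 : D.r (B.flip y) a = c := congrArg Subtype.val h
  have := key a ha
  rw [h0, hc] at this
  have ha0 : a = 0 := hi (by simpa using this.symm)
  rw [← h0, ha0, map_zero]

/-- If `B y` agrees with the counit on the range of `r g`, then `g = g * B y = B (l g y)`. -/
theorem Balanced.range_eq (hB : D.Balanced B) (hi : Function.Injective B)
    (hi' : Function.Injective B.flip) : LinearMap.range B = D.finiteRankLeft := by
  refine le_antisymm (by rintro _ ⟨c, rfl⟩; exact hB.apply_mem c) fun g hg => ?_
  rw [hB.finiteRank_eq hi, mem_finiteRankRight] at hg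
  obtain ⟨_, ⟨y, rfl⟩, hy⟩ := (separating_range_of_injective_flip hi').exists_eqOn
    (LinearMap.range (D.r g)) D.counit
  refine ⟨D.l g y, ?_⟩
  rw [← hB.comp_l]
  ext c
  rw [LinearMap.comp_apply, D.adj, hy _ ⟨c, rfl⟩, counit_r]

theorem Balanced.injective_flip (hB : D.Balanced B) (hi : Function.Injective B)
    (hr : LinearMap.range B = D.finiteRankLeft) : Function.Injective B.flip := by
  rw [injective_iff_map_eq_zero]
  intro c hc
  refine (hB.separating_right hi) c fun p hp => ?_
  obtain ⟨d, rfl⟩ : p ∈ LinearMap.range B := hr ▸ hB.finiteRankRight_le hi hp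
  exact LinearMap.congr_fun hc d

end DualAction

theorem finiteDimensional_of_ker_le {K V U W : Type*} [Field K] [AddCommGroup V] [Module K V]
    [AddCommGroup U] [Module K U] [AddCommGroup W] [Module K W] (f : V →ₗ[K] U) (g : V →ₗ[K] W)
    (hg : Function.Surjective g) (h : LinearMap.ker f ≤ LinearMap.ker g)
    [FiniteDimensional K (LinearMap.range f)] : FiniteDimensional K W := by
  have : FiniteDimensional K (V ⧸ LinearMap.ker f) :=
    Module.Finite.equiv f.quotKerEquivRange.symm
  refine Module.Finite.of_surjective ((LinearMap.ker f).liftQ g h) fun w => ?_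
  obtain ⟨v, rfl⟩ := hg w
  exact ⟨Submodule.Quotient.mk v, rfl⟩

/-! ### Comparing index sets of direct sums. -/

namespace DualAction

variable {K C : Type*} [Field K] [AddCommGroup C] [Module K C] (D : DualAction K C)

theorem exists_apply_ne_zero {P : Submodule K (Dual K C)} (hP : Separating P) {c : C}
    (hc : c ≠ 0) : ∃ p ∈ P, p c ≠ 0 := by
  by_contra! h
  exact hc (hP c h)

variable {I J R : Type*} [AddCommMonoid R] [Module K R] {ι : R →ₗ[K] Dual K C}
  (hι : Function.Injective ι) (hιr : LinearMap.range ι = D.finiteRankRight)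
  (e : (I →₀ C) ≃ₗ[K] (J →₀ R))

include hι hιr

/-- If copies of `C` and of its rational dual have isomorphic direct sums as right modules and the
first sum is finite, then so is the second one. -/
theorem finite_of_finite_left [Nontrivial C] (hr : Separating D.finiteRankRight)
    (he : ∀ f x j, ι (e (x.mapRange (D.r f) (map_zero _)) j) = ι (e x j) ∘ₗ D.l f) [Finite I] : Finite J := by
  obtain ⟨c, hc⟩ := exists_ne (0 : C)
  obtain ⟨p', hp, hpc⟩ := exists_apply_ne_zero hr hc
  obtain ⟨p, rfl⟩ := hιr.ge hp
  let A : Submodule K C := LinearMap.range (D.r (ι p))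
  have hA : FiniteDimensional K A := hp
  have hp0 : Function.Injective (LinearMap.toSpanSingleton K R p) := by
    refine Function.Injective.of_comp (f := ι) fun x y h => ?_
    refine smul_left_injective K (m := ι p) (fun h0 => hpc (by rw [h0, LinearMap.zero_apply])) ?_
    simpa using h
  let s : (J →₀ K) →ₗ[K] (J →₀ R) :=
    Finsupp.mapRange.linearMap (LinearMap.toSpanSingleton K _ p)
  have hs : Function.Injective s :=
    Finsupp.mapRange_injective _ (map_zero _) hp0
  let T : (J →₀ K) →ₗ[K] (I → C) := Finsupp.lcoeFun ∘ₗ e.symm.toLinearMap ∘ₗ s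
  have hT : Function.Injective T :=
    DFunLike.coe_injective.comp (e.symm.injective.comp hs)
  let U : (I → A) →ₗ[K] (I → C) := LinearMap.pi fun i => A.subtype ∘ₗ LinearMap.proj i
  have hTU : LinearMap.range T ≤ LinearMap.range U := by
    rintro _ ⟨k, rfl⟩
    -- If `f` kills `A`, the range of `r (ι p)`, then `ι p * f = 0`; so `f` kills `s k`, and hence
    -- its preimage under `e`, coordinate by coordinate.
    have hmem : ∀ i, T k i ∈ A := by
      intro i
      have hcl : A.dualAnnihilator.dualCoannihilator = A :=
        Subspace.dualAnnihilator_dualCoannihilator_eq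
      rw [← hcl, Submodule.mem_dualCoannihilator]
      intro f hf
      rw [Submodule.mem_dualAnnihilator] at hf
      have hz : (e.symm (s k)).mapRange (D.r f) (map_zero _) = 0 := by
        apply e.injective
        rw [map_zero]
        ext j
        apply hι
        rw [he, e.apply_symm_apply]
        ext d
        change ι (k j • p) (D.l f d) = ι 0 d
        rw [map_smul, map_zero, LinearMap.zero_apply, LinearMap.smul_apply, D.adj, hf _ ⟨d, rfl⟩, smul_zero]
      have hz' : D.r f (T k i) = 0 := DFunLike.congr_fun hz i
      rw [← D.counit_r, hz', map_zero]
    exact ⟨fun i => ⟨T k i, hmem i⟩, rfl⟩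
  have : FiniteDimensional K (LinearMap.range T) := Submodule.finiteDimensional_of_le hTU
  have : FiniteDimensional K (J →₀ K) :=
    Module.Finite.equiv (LinearEquiv.ofInjective T hT).symm
  exact (Module.finite_finsupp_self_iff.1 this).resolve_left (not_subsingleton K)

/-- If copies of `C` and of its rational dual have isomorphic direct sums as right modules and the
second sum is finite, then so is the first one. -/
theorem finite_of_finite_right [Nontrivial C] (hl : Separating D.finiteRankLeft)
    (hr : Separating D.finiteRankRight)
    (he : ∀ f x j, ι (e (x.mapRange (D.r f) (map_zero _)) j) = ι (e x j) ∘ₗ D.l f) [Finite J] : Finite I := by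
  classical
  obtain ⟨a, ha⟩ := exists_ne (0 : C)
  obtain hJ | ⟨⟨j⟩⟩ := isEmpty_or_nonempty J
  · have : Subsingleton (I →₀ C) := e.toEquiv.subsingleton
    have : IsEmpty I := ⟨fun i => ha (by
      simpa using DFunLike.congr_fun (Subsingleton.elim (Finsupp.single i a) 0) i)⟩
    infer_instance
  let A : Submodule K C := LinearMap.range (D.r.flip a)
  have hA : FiniteDimensional K A := D.finite_r a
  obtain ⟨p', hp, hpa⟩ := exists_apply_ne_zero hr ha
  obtain ⟨p, rfl⟩ := hιr.ge hp
  let v : (J →₀ R) →ₗ[K] K :=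
    Dual.eval K C a ∘ₗ ι ∘ₗ Finsupp.lapply j
  have hv : v ∘ₗ e.toLinearMap ≠ 0 := by
    intro h
    apply hpa
    have := LinearMap.congr_fun h (e.symm (Finsupp.single j p))
    simpa [v] using this
  obtain ⟨i, hi⟩ : ∃ i, v ∘ₗ e.toLinearMap ∘ₗ Finsupp.lsingle i ≠ 0 := by
    by_contra! h
    exact hv (Finsupp.lhom_ext' fun i => by simpa [LinearMap.comp_assoc] using h i)
  set w : C →ₗ[K] K := v ∘ₗ e.toLinearMap ∘ₗ Finsupp.lsingle i with hw
  have hwA : ∀ f : Dual K C, (∀ b ∈ A, f b = 0) → ∀ c, w (D.r f c) = 0 := by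
    intro f hf c
    have : Finsupp.single i (D.r f c) =
        (Finsupp.single i c).mapRange (D.r f) (map_zero _) := by simp
    change ι (e (Finsupp.single i (D.r f c)) j) a = 0
    rw [this, he, LinearMap.comp_apply, D.adj]
    exact hf _ ⟨_, rfl⟩
  have hwsurj : Function.Surjective w := LinearMap.surjective hi
  -- Although `w` comes from a single index `i`, it is applied in every coordinate: `hwA` concerns
  -- all of `C`.
  let L : (I →₀ C) →ₗ[K] (I →₀ K) := Finsupp.mapRange.linearMap w
  have hL : Function.Surjective L := Finsupp.mapRange_surjective _ (map_zero _) hwsurj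
  let ρ : (J →₀ R) →ₗ[K] (J → Dual K A) :=
    LinearMap.pi fun j => A.subtype.dualMap ∘ₗ ι ∘ₗ Finsupp.lapply j
  have hker : LinearMap.ker (ρ ∘ₗ e.toLinearMap) ≤ LinearMap.ker L := by
    intro x hx
    obtain ⟨y, rfl⟩ := e.symm.surjective x
    rw [LinearMap.mem_ker] at hx ⊢
    have hy : ρ y = 0 := by simpa using hx
    have hyA : ∀ j, ∀ b ∈ A, ι (y j) b = 0 := fun j b hb =>
      LinearMap.congr_fun (congrFun hy j) ⟨b, hb⟩
    -- A local unit writes `y j` as a product `q * y j`, so each summand of `e.symm y` has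
    -- coordinates `r (ι (y j)) c`, which `w` kills because `y j` vanishes on `A`.
    have hunit : ∀ j, ∃ q, ι q ∘ₗ D.l (ι (y j)) = ι (y j) := by
      intro j
      have : FiniteDimensional K (LinearMap.range (D.l (ι (y j)))) :=
        (D.finiteRank_eq hl hr).ge (hιr.le ⟨_, rfl⟩)
      obtain ⟨q', hq, hqe⟩ := hr.exists_eqOn (LinearMap.range (D.l (ι (y j)))) D.counit
      obtain ⟨q, rfl⟩ := hιr.ge hq
      refine ⟨q, ?_⟩
      ext c
      rw [LinearMap.comp_apply, hqe _ ⟨c, rfl⟩, counit_l]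
    choose q hq using hunit
    have hsingle : ∀ j, L (e.symm (Finsupp.single j (y j))) = 0 := by
      intro j
      have h : Finsupp.single j (y j) = e ((e.symm (Finsupp.single j (q j))).mapRange
          (D.r (ι (y j))) (map_zero _)) := by
        ext j'
        apply hι
        rw [he, e.apply_symm_apply]
        by_cases hj : j = j'
        · subst hj
          simp [hq]
        · simp [Finsupp.single_eq_of_ne' hj]
      rw [h, e.symm_apply_apply]
      ext i
      exact hwA _ (hyA j) _
    have hsum : y = y.sum Finsupp.single := (Finsupp.sum_single y).symm
    rw [hsum, Finsupp.sum, map_sum, map_sum]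
    exact Finset.sum_eq_zero fun j _ => hsingle j
  have : FiniteDimensional K (I →₀ K) :=
    finiteDimensional_of_ker_le (ρ ∘ₗ e.toLinearMap) L hL hker
  exact (Module.finite_finsupp_self_iff.1 this).resolve_left (not_subsingleton K)

end DualAction

/-! ### Finiteness of contractions of a tensor. -/

section Contraction

variable {K C M : Type*} [Field K] [AddCommGroup C] [Module K C] [AddCommGroup M] [Module K M]

theorem exists_finite_forall_rid_mem (t : M ⊗[K] C) : ∃ W : Submodule K M,
    FiniteDimensional K W ∧ ∀ f : Dual K C, TensorProduct.rid K M (f.lTensor M t) ∈ W := by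
  induction t with
  | zero => exact ⟨⊥, inferInstance, fun f => by simp⟩
  | tmul m c =>
    exact ⟨K ∙ m, inferInstance, fun f => by
      simpa using Submodule.smul_mem _ _ (Submodule.mem_span_singleton_self m)⟩
  | add x y hx hy =>
    obtain ⟨V, hV, hx⟩ := hx
    obtain ⟨W, hW, hy⟩ := hy
    exact ⟨V ⊔ W, inferInstance, fun f => by
      rw [map_add, map_add]
      exact Submodule.add_mem_sup (hx f) (hy f)⟩

theorem exists_finite_forall_lid_mem (t : C ⊗[K] M) : ∃ W : Submodule K M,
    FiniteDimensional K W ∧ ∀ f : Dual K C, TensorProduct.lid K M (f.rTensor M t) ∈ W := by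
  induction t with
  | zero => exact ⟨⊥, inferInstance, fun f => by simp⟩
  | tmul c m =>
    exact ⟨K ∙ m, inferInstance, fun f => by
      simpa using Submodule.smul_mem _ _ (Submodule.mem_span_singleton_self m)⟩
  | add x y hx hy =>
    obtain ⟨V, hV, hx⟩ := hx
    obtain ⟨W, hW, hy⟩ := hy
    exact ⟨V ⊔ W, inferInstance, fun f => by
      rw [map_add, map_add]
      exact Submodule.add_mem_sup (hx f) (hy f)⟩

end Contraction

/-! ### From coalgebras to adjoint actions and balanced forms. -/

section Coalgebra

variable {K C : Type*} [Field K] [AddCommGroup C] [Module K C] [Coalgebra K C]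

theorem mul_apply_eq_leftAct (f g : DualAlg K C) (c : C) :
    (f * g).ofConv c = f.ofConv (leftAct g c) := by
  change (f * g) c = _
  rw [LinearMap.convMul_apply, leftAct, LinearMap.comp_apply, LinearMap.comp_apply]
  induction (Coalgebra.comul (R := K) c) with
  | zero => simp
  | add x y hx hy => simp only [map_add, hx, hy]
  | tmul a b => simp [mul_comm]

theorem mul_apply_eq_rightAct (f g : DualAlg K C) (c : C) :
    (f * g).ofConv c = g.ofConv (rightAct f c) := by
  change (f * g) c = _
  rw [LinearMap.convMul_apply, rightAct, LinearMap.comp_apply, LinearMap.comp_apply]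
  induction (Coalgebra.comul (R := K) c) with
  | zero => simp
  | add x y hx hy => simp only [map_add, hx, hy]
  | tmul a b => simp

variable (K C) in
/-- The two actions of the dual algebra of a coalgebra `C` on `C`. -/
def dualAction : DualAction K C where
  l :=
    { toFun f := leftAct (toConv f)
      map_add' f g := LinearMap.ext fun c => add_smul (toConv f) (toConv g) c
      map_smul' a f := by
        ext c
        simp [leftAct, LinearMap.lTensor_smul] }
  r :=
    { toFun f := rightAct (toConv f)
      map_add' f g := LinearMap.ext fun c =>
        add_smul (MulOpposite.op (toConv f)) (MulOpposite.op (toConv g)) c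
      map_smul' a f := by
        ext c
        simp [rightAct, LinearMap.rTensor_smul] }
  counit := Coalgebra.counit
  l_counit c := one_smul (DualAlg K C) c
  r_counit c := one_smul (DualAlg K C)ᵐᵒᵖ c
  adj f g c := by
    change (toConv f).ofConv (leftAct (toConv g) c) = (toConv g).ofConv (rightAct (toConv f) c)
    rw [← mul_apply_eq_rightAct, ← mul_apply_eq_leftAct]
  comm f g c := by
    refine dual_ext (K := K) fun h => ?_
    change (toConv h).ofConv (leftAct (toConv f) (rightAct (toConv g) c)) =
      (toConv h).ofConv (rightAct (toConv g) (leftAct (toConv f) c))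
    rw [← mul_apply_eq_leftAct, ← mul_apply_eq_rightAct, ← mul_apply_eq_rightAct,
      ← mul_apply_eq_leftAct, mul_assoc]
  finite_l c := by
    obtain ⟨W, hW, h⟩ := exists_finite_forall_rid_mem (Coalgebra.comul (R := K) c)
    refine Submodule.finiteDimensional_of_le (S₂ := W) ?_
    rintro _ ⟨f, rfl⟩
    exact h f
  finite_r c := by
    obtain ⟨W, hW, h⟩ := exists_finite_forall_lid_mem (Coalgebra.comul (R := K) c)
    refine Submodule.finiteDimensional_of_le (S₂ := W) ?_
    rintro _ ⟨f, rfl⟩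
    exact h f

instance isScalarTower_left : IsScalarTower K (DualAlg K C) C where
  smul_assoc a f c := LinearMap.congr_fun ((dualAction K C).l.map_smul a f.ofConv) c

instance isScalarTower_right : IsScalarTower K (DualAlg K C)ᵐᵒᵖ C where
  smul_assoc a f c := LinearMap.congr_fun ((dualAction K C).r.map_smul a f.unop.ofConv) c

/-- Since `f * g = f ∘ leftAct g`, the orbit of `g` is the range of the transpose of `leftAct g`,
and a tensor confines it to a finite-dimensional space. Conversely, coordinates in a basis of the
range of `leftAct g` supply the tensor. -/
theorem mem_leftRat {g : DualAlg K C} :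
    g ∈ leftRat K C (DualAlg K C) ↔ g.ofConv ∈ (dualAction K C).finiteRankLeft := by
  constructor
  · rintro ⟨t, ht⟩
    obtain ⟨W, hW, h⟩ := exists_finite_forall_rid_mem t
    refine finite_range_of_finite_range_dualMap _ ?_
    refine Submodule.finiteDimensional_of_le
      (S₂ := W.map (WithConv.linearEquiv K (C →ₗ[K] K)).toLinearMap) ?_
    rintro _ ⟨f, rfl⟩
    refine ⟨toConv f * g, ?_, ?_⟩
    · rw [← smul_eq_mul, ht]
      exact h f
    · ext c
      exact mul_apply_eq_leftAct (toConv f) g c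
  · intro (hg : FiniteDimensional K (LinearMap.range (leftAct g)))
    let b := Module.finBasis K (LinearMap.range (leftAct g))
    refine ⟨∑ i, toConv (b.coord i ∘ₗ (leftAct g).rangeRestrict) ⊗ₜ[K] (b i : C), fun f => ?_⟩
    ext c
    rw [smul_eq_mul, mul_apply_eq_leftAct]
    have h : leftAct g c = _ := congrArg Subtype.val (b.sum_repr ((leftAct g).rangeRestrict c)).symm
    rw [Submodule.coe_sum] at h
    refine (congrArg f.ofConv h).trans ?_
    simp [mul_comm]

theorem mem_rightRat {g : DualAlg K C} :
    g ∈ rightRat K C (DualAlg K C) ↔ g.ofConv ∈ (dualAction K C).finiteRankRight := by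
  constructor
  · rintro ⟨t, ht⟩
    obtain ⟨W, hW, h⟩ := exists_finite_forall_lid_mem t
    refine finite_range_of_finite_range_dualMap _ ?_
    refine Submodule.finiteDimensional_of_le
      (S₂ := W.map (WithConv.linearEquiv K (C →ₗ[K] K)).toLinearMap) ?_
    rintro _ ⟨f, rfl⟩
    refine ⟨g * toConv f, ?_, ?_⟩
    · rw [← op_smul_eq_mul, ht]
      exact h f
    · ext c
      exact mul_apply_eq_rightAct g (toConv f) c
  · intro (hg : FiniteDimensional K (LinearMap.range (rightAct g)))
    let b := Module.finBasis K (LinearMap.range (rightAct g))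
    refine ⟨∑ i, (b i : C) ⊗ₜ[K] toConv (b.coord i ∘ₗ (rightAct g).rangeRestrict), fun f => ?_⟩
    ext c
    rw [op_smul_eq_mul, mul_apply_eq_rightAct]
    have h : rightAct g c = _ := congrArg Subtype.val (b.sum_repr ((rightAct g).rangeRestrict c)).symm
    rw [Submodule.coe_sum] at h
    refine (congrArg f.ofConv h).trans ?_
    simp [mul_comm]

/-- The bilinear form of a map of left modules from `C` to its dual. -/
noncomputable def leftForm (φ : C →ₗ[DualAlg K C] DualAlg K C) : C →ₗ[K] Dual K C :=
  (WithConv.linearEquiv K (C →ₗ[K] K)).toLinearMap ∘ₗ φ.restrictScalars K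

/-- The bilinear form of a map of right modules from `C` to its dual. -/
noncomputable def rightForm (φ : C →ₗ[(DualAlg K C)ᵐᵒᵖ] DualAlg K C) : C →ₗ[K] Dual K C :=
  ((WithConv.linearEquiv K (C →ₗ[K] K)).toLinearMap ∘ₗ φ.restrictScalars K).flip

theorem balanced_leftForm (φ : C →ₗ[DualAlg K C] DualAlg K C) :
    (dualAction K C).Balanced (leftForm φ) := by
  intro f c d
  have h : φ (leftAct (toConv f) c) = toConv f * φ c := φ.map_smul (toConv f) c
  change (φ (leftAct (toConv f) c)).ofConv d = _
  rw [h, mul_apply_eq_rightAct]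
  rfl

/-- The flip in `rightForm` makes right module maps obey the same balance law as left ones, so both
kinds can be compared as forms. -/
theorem balanced_rightForm (φ : C →ₗ[(DualAlg K C)ᵐᵒᵖ] DualAlg K C) :
    (dualAction K C).Balanced (rightForm φ) := by
  intro f c d
  have h : φ (rightAct (toConv f) d) = φ d * toConv f := φ.map_smul (MulOpposite.op (toConv f)) d
  change _ = (φ (rightAct (toConv f) d)).ofConv c
  rw [h, mul_apply_eq_leftAct]
  rfl

theorem injective_leftForm {φ : C →ₗ[DualAlg K C] DualAlg K C} :
    Function.Injective (leftForm φ) ↔ Function.Injective φ :=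
  ofConv_injective.of_comp_iff φ

theorem injective_flip_rightForm {φ : C →ₗ[(DualAlg K C)ᵐᵒᵖ] DualAlg K C} :
    Function.Injective (rightForm φ).flip ↔ Function.Injective φ :=
  ofConv_injective.of_comp_iff φ

/-- The map of left modules from `C` to its dual given by a balanced form. -/
def leftHom (B : C →ₗ[K] Dual K C) (hB : (dualAction K C).Balanced B) :
    C →ₗ[DualAlg K C] DualAlg K C where
  toFun c := toConv (B c)
  map_add' c d := by rw [map_add, toConv_add]
  map_smul' f c := by
    ext d
    rw [RingHom.id_apply, smul_eq_mul, mul_apply_eq_rightAct]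
    exact hB f.ofConv c d

/-- The map of right modules from `C` to its dual given by a balanced form. -/
def rightHom (B : C →ₗ[K] Dual K C) (hB : (dualAction K C).Balanced B) :
    C →ₗ[(DualAlg K C)ᵐᵒᵖ] DualAlg K C where
  toFun c := toConv (B.flip c)
  map_add' c d := by rw [map_add, toConv_add]
  map_smul' f c := by
    ext d
    rw [RingHom.id_apply, MulOpposite.smul_eq_mul_unop, mul_apply_eq_leftAct]
    exact (hB f.unop.ofConv d c).symm

theorem isLeftCoFrobenius_iff : IsLeftCoFrobenius K C ↔
    ∃ B, (dualAction K C).Balanced B ∧ Function.Injective B :=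
  ⟨fun ⟨φ, hφ⟩ => ⟨leftForm φ, balanced_leftForm φ, injective_leftForm.2 hφ⟩,
    fun ⟨B, hB, hi⟩ => ⟨leftHom B hB, injective_leftForm.1 hi⟩⟩

theorem isRightCoFrobenius_iff : IsRightCoFrobenius K C ↔
    ∃ B, (dualAction K C).Balanced B ∧ Function.Injective B.flip :=
  ⟨fun ⟨φ, hφ⟩ => ⟨rightForm φ, balanced_rightForm φ, injective_flip_rightForm.2 hφ⟩,
    fun ⟨B, hB, hi⟩ => ⟨rightHom B hB, injective_flip_rightForm.1 hi⟩⟩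

/-- A coalgebra is co-Frobenius if and only if it has a non-degenerate balanced form. -/
theorem isCoFrobenius_iff : IsCoFrobenius K C ↔
    ∃ B, (dualAction K C).Balanced B ∧ Function.Injective B ∧ Function.Injective B.flip := by
  rw [IsCoFrobenius, isLeftCoFrobenius_iff, isRightCoFrobenius_iff]
  constructor
  · rintro ⟨⟨B, hB, hi⟩, B', hB', hi'⟩
    exact ⟨B', hB', hB.injective hi hB' hi', hi'⟩
  · rintro ⟨B, hB, hi, hi'⟩
    exact ⟨⟨B, hB, hi⟩, B, hB, hi'⟩

theorem nonempty_equiv_leftRat_iff :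
    Nonempty (C ≃ₗ[DualAlg K C] leftRat K C (DualAlg K C)) ↔
      ∃ B, (dualAction K C).Balanced B ∧ Function.Injective B ∧
        LinearMap.range B = (dualAction K C).finiteRankLeft := by
  constructor
  · rintro ⟨e⟩
    let φ := (leftRat K C (DualAlg K C)).subtype ∘ₗ e.toLinearMap
    refine ⟨leftForm φ, balanced_leftForm φ,
      injective_leftForm.2 (Subtype.val_injective.comp e.injective), le_antisymm ?_ ?_⟩
    · rintro _ ⟨c, rfl⟩
      exact (balanced_leftForm φ).apply_mem c
    · intro g hg
      obtain ⟨c, hc⟩ := e.surjective ⟨toConv g, mem_leftRat.2 hg⟩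
      exact ⟨c, congrArg (fun x => x.1.ofConv) hc⟩
  · rintro ⟨B, hB, hi, hr⟩
    have hmem : ∀ c, leftHom B hB c ∈ leftRat K C (DualAlg K C) := fun c =>
      mem_leftRat.2 (hB.apply_mem c)
    refine ⟨LinearEquiv.ofBijective ((leftHom B hB).codRestrict _ hmem) ⟨?_, ?_⟩⟩
    · exact (LinearMap.injective_codRestrict_iff _).2 (injective_leftForm.1 hi)
    · rintro ⟨g, hg⟩
      obtain ⟨c, hc⟩ := hr.ge (mem_leftRat.1 hg)
      exact ⟨c, Subtype.ext (WithConv.ext hc)⟩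

theorem nonempty_equiv_rightRat_iff :
    Nonempty (C ≃ₗ[(DualAlg K C)ᵐᵒᵖ] rightRat K C (DualAlg K C)) ↔
      ∃ B, (dualAction K C).Balanced B ∧ Function.Injective B.flip ∧
        LinearMap.range B.flip = (dualAction K C).finiteRankRight := by
  constructor
  · rintro ⟨e⟩
    let φ := (rightRat K C (DualAlg K C)).subtype ∘ₗ e.toLinearMap
    refine ⟨rightForm φ, balanced_rightForm φ,
      injective_flip_rightForm.2 (Subtype.val_injective.comp e.injective), le_antisymm ?_ ?_⟩
    · rintro _ ⟨c, rfl⟩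
      exact (balanced_rightForm φ).flip_apply_mem c
    · intro g hg
      obtain ⟨c, hc⟩ := e.surjective ⟨toConv g, mem_rightRat.2 hg⟩
      exact ⟨c, congrArg (fun x => x.1.ofConv) hc⟩
  · rintro ⟨B, hB, hi, hr⟩
    have hmem : ∀ c, rightHom B hB c ∈ rightRat K C (DualAlg K C) := fun c =>
      mem_rightRat.2 (hB.flip_apply_mem c)
    refine ⟨LinearEquiv.ofBijective ((rightHom B hB).codRestrict _ hmem) ⟨?_, ?_⟩⟩
    · exact (LinearMap.injective_codRestrict_iff _).2 (injective_flip_rightForm.1 hi)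
    · rintro ⟨g, hg⟩
      obtain ⟨c, hc⟩ := hr.ge (mem_rightRat.1 hg)
      exact ⟨c, Subtype.ext (WithConv.ext hc)⟩

theorem isCoFrobenius_iff_leftRat : IsCoFrobenius K C ↔
    Nonempty (C ≃ₗ[DualAlg K C] leftRat K C (DualAlg K C)) := by
  rw [isCoFrobenius_iff, nonempty_equiv_leftRat_iff]
  constructor
  · rintro ⟨B, hB, hi, hi'⟩
    exact ⟨B, hB, hi, hB.range_eq hi hi'⟩
  · rintro ⟨B, hB, hi, hr⟩
    exact ⟨B, hB, hi, hB.injective_flip hi hr⟩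

theorem isCoFrobenius_iff_rightRat : IsCoFrobenius K C ↔
    Nonempty (C ≃ₗ[(DualAlg K C)ᵐᵒᵖ] rightRat K C (DualAlg K C)) := by
  rw [isCoFrobenius_iff, nonempty_equiv_rightRat_iff]
  constructor
  · rintro ⟨B, hB, hi, hi'⟩
    exact ⟨B, hB, hi', hB.flip.range_eq hi' hi⟩
  · rintro ⟨B, hB, hi', hr⟩
    exact ⟨B, hB, hB.flip.injective_flip hi' hr, hi'⟩

/-- Each coordinate of the embedding is a balanced form `B`, and every `B.flip d` has finite right
rank; jointly these functionals detect all of `C`. -/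
theorem separating_finiteRankRight (h : IsLeftQcF K C) :
    Separating (dualAction K C).finiteRankRight := by
  obtain ⟨I, φ, hφ⟩ := h
  intro c hc
  apply hφ
  rw [map_zero]
  ext i d
  exact hc _ ((balanced_leftForm (Finsupp.lapply i ∘ₗ φ)).flip_apply_mem d)

theorem separating_finiteRankLeft (h : IsRightQcF K C) :
    Separating (dualAction K C).finiteRankLeft := by
  obtain ⟨I, φ, hφ⟩ := h
  intro c hc
  apply hφ
  rw [map_zero]
  ext i d
  exact hc _ ((balanced_rightForm (Finsupp.lapply i ∘ₗ φ)).apply_mem d)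

variable (K C) in
/-- The inclusion of the rational part of the right module `C*` into the functionals. -/
noncomputable def rightRatInclusion : rightRat K C (DualAlg K C) →ₗ[K] Dual K C :=
  (WithConv.linearEquiv K (C →ₗ[K] K)).toLinearMap ∘ₗ
    (rightRat K C (DualAlg K C)).subtype.restrictScalars K

theorem rightRatInclusion_injective : Function.Injective (rightRatInclusion K C) :=
  ofConv_injective.comp Subtype.val_injective

theorem range_rightRatInclusion :
    LinearMap.range (rightRatInclusion K C) = (dualAction K C).finiteRankRight := by
  refine le_antisymm ?_ fun g hg => ⟨⟨toConv g, mem_rightRat.2 hg⟩, rfl⟩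
  rintro _ ⟨g, rfl⟩
  exact mem_rightRat.1 g.2

theorem rightRatInclusion_smul (f : Dual K C) (g : rightRat K C (DualAlg K C)) :
    rightRatInclusion K C (MulOpposite.op (toConv f) • g) =
      rightRatInclusion K C g ∘ₗ (dualAction K C).l f := by
  ext c
  exact mul_apply_eq_leftAct g.1 (toConv f) c

theorem finite_iff_finite [Nontrivial C] (h : IsQcF K C) {I J : Type*}
    (e : (I →₀ C) ≃ₗ[(DualAlg K C)ᵐᵒᵖ] (J →₀ rightRat K C (DualAlg K C))) :
    Finite I ↔ Finite J := by
  have hr := separating_finiteRankRight h.1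
  have hl := separating_finiteRankLeft h.2
  let e' : (I →₀ C) ≃ₗ[K] (J →₀ rightRat K C (DualAlg K C)) := e.restrictScalars K
  have he : ∀ f x j,
      rightRatInclusion K C (e' (x.mapRange ((dualAction K C).r f) (map_zero _)) j) =
        rightRatInclusion K C (e' x j) ∘ₗ (dualAction K C).l f := by
    intro f x j
    have hx : x.mapRange ((dualAction K C).r f) (map_zero _) =
        MulOpposite.op (toConv f) • x := Finsupp.ext fun i => rfl
    have hj : e' (MulOpposite.op (toConv f) • x) = MulOpposite.op (toConv f) • e' x :=
      e.map_smul (MulOpposite.op (toConv f)) x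
    rw [hx, hj, Finsupp.smul_apply, rightRatInclusion_smul]
  exact ⟨fun _ => (dualAction K C).finite_of_finite_left rightRatInclusion_injective
      range_rightRatInclusion e' hr he,
    fun _ => (dualAction K C).finite_of_finite_right rightRatInclusion_injective
      range_rightRatInclusion e' hl hr he⟩

end Coalgebra

end CoalgebraDual

theorem proposition2p1 {K : Type*} {C : Type*} [Field K] [AddCommGroup C] [Module K C]
    [Coalgebra K C] :
    (Nontrivial C → CoalgebraDual.IsQcF K C → ∀ (I : Type*) (J : Type*),
      Nonempty ((I →₀ C) ≃ₗ[(CoalgebraDual.DualAlg K C)ᵐᵒᵖ]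
        (J →₀ CoalgebraDual.rightRat K C (CoalgebraDual.DualAlg K C))) →
      (Finite I ↔ Finite J)) ∧
    (CoalgebraDual.IsCoFrobenius K C ↔
      Nonempty (C ≃ₗ[CoalgebraDual.DualAlg K C]
        CoalgebraDual.leftRat K C (CoalgebraDual.DualAlg K C))) ∧
    (CoalgebraDual.IsCoFrobenius K C ↔
      Nonempty (C ≃ₗ[(CoalgebraDual.DualAlg K C)ᵐᵒᵖ]
        CoalgebraDual.rightRat K C (CoalgebraDual.DualAlg K C))) := by
  refine ⟨fun hC h I J ⟨e⟩ => ?_, CoalgebraDual.isCoFrobenius_iff_leftRat,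
    CoalgebraDual.isCoFrobenius_iff_rightRat⟩
  exact CoalgebraDual.finite_iff_finite h e
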